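/- There exist a separable complex Hilbert space $H$ and a triple $(A,B,\Phi)$ such that 1. $A$ is a (possibly unbounded) skew-adjoint operator on $H$ with dense domain $D(A)$, and $\mathrm{i}A$ is positive: $\langle\psi,\mathrm{i}A\psi\rangle\ge 0$ for all $\psi\in D(A)$; 2. $B$ is skew-symmetric on $D(A)$ and bounded relatively to $A$: there are $a,b\in\mathbf{R}$ with $\|B\psi\|\le a\|A\psi\|+b\|\psi\|$ for all $\psi\in D(A)$; 3. $\Phi=(\phi_j)_{j\ge 1}$ is a Hilbert basis of $H$ made of eigenvectors of $A$: $A\phi_j=-\mathrm{i}\lambda_j\phi_j$ with $\lambda_j\in\mathbf{R}$; 4. $B$ is a bounded operator on $H$; and for every real $M\ge 0$ there exist $T_M>0$ and a control $u_M:[0,T_M]\to\mathbf{R}$ of bounded variation with $u_M(0)=0$ such that $$\|A\Upsilon^{u_M}_{T_M}\phi_1\|\ \ge\ M\qquad\text{and}\qquad M\ \ge\ \frac{\|B\|}{4}\,TV_{[0,T_M]}(u_M).$$ Here $TV$ denotes the total variation and $t\mapsto\Upsilon^{u}_t$ is the propagator of $\psi'(t)=A\psi(t)+u(t)B\psi(t)$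 on $[0,T_M]$: the strongly continuous family of unitary operators with $\Upsilon^u_0=\mathrm{Id}$, leaving $D(A)$ invariant, such that for every $\psi\in D(A)$ the curve $t\mapsto\Upsilon^u_t\psi$ is absolutely continuous and satisfies the equation for almost every $t$. -/

import Mathlib

open MeasureTheory

/-- A densely defined, possibly unbounded, operator `A` with `A* = -A` (domains included). -/
def IsSkewAdjointOp {H : Type*} [NormedAddCommGroup H] [InnerProductSpace ℂ H] [CompleteSpace H]
    (A : H →ₗ.[ℂ] H) : Prop :=
  Dense (A.domain : Set H) ∧ A.adjoint = -A

/-- The structural hypotheses on the triple `(A, B, Φ)` of a bilinear quantum system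
`ψ' = A ψ + u(t) B ψ` on a complex Hilbert space: `A` is skew-adjoint, `i A` is positive, `B` is
skew-symmetric on `D(A)` and bounded relatively to `A`, and `Φ = (φ₁, φ₂, …)` is a Hilbert basis
made of eigenvectors of `A`. -/
structure IsBilinearQuantumSystem {H : Type*} [NormedAddCommGroup H] [InnerProductSpace ℂ H]
    [CompleteSpace H] (A B : H →ₗ.[ℂ] H) (φ : HilbertBasis ℕ+ ℂ H) : Prop where
  skewAdjoint : IsSkewAdjointOp A
  positive : ∀ ψ : A.domain, 0 ≤ (inner ℂ (ψ : H) (Complex.I • A ψ)).re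
  domain_le : A.domain ≤ B.domain
  skewSymmetric : ∀ (ψ χ : B.domain), (ψ : H) ∈ A.domain → (χ : H) ∈ A.domain →
    inner ℂ (B ψ) (χ : H) = -inner ℂ (ψ : H) (B χ)
  relativelyBounded : ∃ a b : ℝ, ∀ (ψ : H) (hA : ψ ∈ A.domain) (hB : ψ ∈ B.domain),
    ‖B ⟨ψ, hB⟩‖ ≤ a * ‖A ⟨ψ, hA⟩‖ + b * ‖ψ‖
  eigenvectors : ∀ j : ℕ+, ∃ (h : φ j ∈ A.domain) (l : ℝ),
    A ⟨φ j, h⟩ = (-(Complex.I * (l : ℂ))) • φ j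

/-- `U` is the propagator on `[0, T]` of `ψ' = A ψ + u(t) B ψ`: a strongly continuous family of
unitary operators with `U 0 = 1`, leaving `D(A)` invariant, such that for every `ψ ∈ D(A)` the
curve `t ↦ U t ψ` is absolutely continuous and solves the equation at almost every time.
(Differentiability almost everywhere alone would not determine the curve.) Only the values `U t`
with `0 ≤ t ≤ T` matter. -/
structure IsPropagator {H : Type*} [NormedAddCommGroup H] [InnerProductSpace ℂ H]
    (A B : H →ₗ.[ℂ] H) (u : ℝ → ℝ) (T : ℝ) (U : ℝ → (H ≃ₗᵢ[ℂ] H)) : Prop where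
  init : ∀ ψ : H, U 0 ψ = ψ
  continuousOn : ∀ ψ : H, ContinuousOn (fun t => U t ψ) (Set.Icc 0 T)
  mem_domain : ∀ ψ ∈ A.domain, ∀ t ∈ Set.Icc 0 T, U t ψ ∈ A.domain
  absolutelyContinuous : ∀ ψ ∈ A.domain,
    AbsolutelyContinuousOnInterval (fun t => U t ψ) 0 T
  equation : ∀ ψ ∈ A.domain, ∀ᵐ t ∂(volume.restrict (Set.Icc 0 T)),
    ∃ (hA : U t ψ ∈ A.domain) (hB : U t ψ ∈ B.domain),
      HasDerivAt (fun s => U s ψ) (A ⟨U t ψ, hA⟩ + (u t : ℂ) • B ⟨U t ψ, hB⟩) t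

/-- An everywhere defined bounded operator, seen as an operator with domain the whole space. -/
def boundedOp {H : Type*} [NormedAddCommGroup H] [InnerProductSpace ℂ H] (B : H →L[ℂ] H) :
    H →ₗ.[ℂ] H :=
  (B : H →ₗ[ℂ] H).toPMap ⊤

/-!
The example lives on `ℓ²(ℕ+)`. The drift is `A = -i N`, where `N e_k = k e_k`, the coupling is
`B = -i (S + S*)` with `S e_k = e_{k+1}`, and the control is the resonant `u t = ε sin t`. All the
gaps of `N` equal `1`, so this one control drives every transition `e_k ↔ e_{k+1}` at the same time
and the energy climbs at a constant speed.

In the interaction picture `U t = exp (t A) V t` the generator is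
`ε (-i sin t) (e^{it} S + e^{-it} S*)`, which is continuous for the operator norm, so `V` is given
by a Dyson series (`exists_hasDerivAt_mul`) and is unitary. The unbounded operator enters only
through its bounded inverse `R = N⁻¹`. The relation `R S (1 + R) = S R` says that `N S R` is the
bounded operator `S (1 + R)`; likewise `N S* R` is `S* (1 - R)`. Hence `N V R` solves a linear
equation of the same kind. This shows that the domain of `A`, the range of `R`, is invariant, and it
reduces `‖A (U t e₁)‖` to the norm of a curve `x` with
`x' = ε (-i sin t) (e^{it} S (1 + R) + e^{-it} S* (1 - R)) x` and `x 0 = e₁`.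

Over a period the generator of this curve has mean `(ε / 2) K₁` with
`K₁ = S (1 + R) - S* (1 - R) = N (S - S*) R`. A corrector and Grönwall's inequality
(`exists_norm_sub_le_of_averaging`) show that at time `2 τ / ε` the curve is `O(ε)`-close to
`z τ`, where `z' = K₁ z` and `z 0 = e₁`. For this autonomous equation the energy is explicit:
`‖z τ‖² = 1 + 3 τ²` (`norm_sq_eq_one_add_three_mul_sq`). On the other side the variation of `u` on
`[0, T]` is at most `ε T`, which is `2 τ` for `T = 2 τ / ε`, and `‖B‖ ≤ 2`, so that
`‖B‖ / 4` times the variation is at most `τ`. Taking `τ = M` and `ε` small, the strict inequality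
`M < √(1 + 3 M²)` absorbs the averaging error. The case `M = 0` is the free evolution.
-/

/-! ### Linear differential equations with bounded coefficients -/

/-- Global solution of `V' = L V`, `V 0 = 1` in a Banach algebra: it is the sum of the Dyson series
`D 0 = 1`, `D (n + 1) t = ∫₀ᵗ L s * D n s`, dominated by the exponential series. -/
theorem exists_hasDerivAt_mul {𝔸 : Type*} [NormedRing 𝔸] [NormedAlgebra ℝ 𝔸] [CompleteSpace 𝔸]
    (L : ℝ → 𝔸) (hL : Continuous L) {C : ℝ} (hC : ∀ t, ‖L t‖ ≤ C) :
    ∃ V : ℝ → 𝔸, V 0 = 1 ∧ ∀ t, HasDerivAt V (L t * V t) t := by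
  have hC0 : 0 ≤ C := (norm_nonneg _).trans (hC 0)
  let D : ℕ → ℝ → 𝔸 := fun n => Nat.rec (fun _ => 1) (fun _ d t => ∫ s in (0 : ℝ)..t, L s * d s) n
  have D0 : ∀ t, D 0 t = 1 := fun _ => rfl
  have Ds : ∀ n t, D (n + 1) t = ∫ s in (0 : ℝ)..t, L s * D n s := fun _ _ => rfl
  have Dc : ∀ n, Continuous (D n) := by
    intro n
    induction n with
    | zero => exact continuous_const
    | succ n ih =>
      exact intervalIntegral.continuous_primitive
        (fun a b => (hL.mul ih).intervalIntegrable a b) 0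
  have Dd : ∀ n t, HasDerivAt (D (n + 1)) (L t * D n t) t := fun n t =>
    intervalIntegral.integral_hasDerivAt_right ((hL.mul (Dc n)).intervalIntegrable _ _)
      (hL.mul (Dc n)).stronglyMeasurable.stronglyMeasurableAtFilter (hL.mul (Dc n)).continuousAt
  have Db : ∀ n t, ‖D n t‖ ≤ ‖(1 : 𝔸)‖ * ((C * |t|) ^ n / n.factorial) := by
    intro n
    induction n with
    | zero => intro t; simp [D0]
    | succ n ih =>
      intro t
      rw [Ds]
      refine (intervalIntegral.norm_integral_le_integral_norm_uIoc).trans ?_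
      have h1 : ∫ s in Set.uIoc 0 t, ‖L s * D n s‖ ≤
          ∫ s in Set.uIoc 0 t, (C * (‖(1 : 𝔸)‖ * (C ^ n / n.factorial))) * |s - 0| ^ n := by
        refine setIntegral_mono_on ?_ ?_ measurableSet_uIoc ?_
        · exact (intervalIntegrable_iff.1 ((hL.mul (Dc n)).norm.intervalIntegrable 0 t))
        · refine (intervalIntegrable_iff.1 (Continuous.intervalIntegrable ?_ 0 t))
          fun_prop
        · intro s _
          calc ‖L s * D n s‖ ≤ ‖L s‖ * ‖D n s‖ := norm_mul_le _ _
            _ ≤ C * (‖(1 : 𝔸)‖ * ((C * |s|) ^ n / n.factorial)) := by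
              gcongr
              · exact hC s
              · exact ih s
            _ = _ := by rw [sub_zero]; ring
      refine h1.trans (le_of_eq ?_)
      rw [integral_const_mul, integral_pow_abs_sub_uIoc, sub_zero, Nat.factorial_succ]
      push_cast
      field_simp
      ring
  have hs : ∀ r : ℝ, Summable fun n : ℕ => ‖(1 : 𝔸)‖ * ((C * r) ^ n / n.factorial) := fun r =>
    (Real.summable_pow_div_factorial (C * r)).mul_left _
  have hsum : ∀ t, Summable fun n => D n t := fun t =>
    Summable.of_norm_bounded (hs |t|) fun n => Db n t
  refine ⟨fun t => ∑' n, D n t, ?_, fun t => ?_⟩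
  · dsimp only
    rw [tsum_eq_single 0]
    · exact D0 0
    · intro n hn
      obtain ⟨m, rfl⟩ := Nat.exists_eq_succ_of_ne_zero hn
      rw [Nat.succ_eq_add_one, Ds, intervalIntegral.integral_same]
  · have hr : t ∈ Metric.ball (0 : ℝ) (|t| + 1) := by simp
    have h := hasDerivAt_tsum_of_isPreconnected (u := fun n => C * (‖(1 : 𝔸)‖ *
        ((C * (|t| + 1)) ^ n / n.factorial))) (g := fun n => D (n + 1))
        (g' := fun n s => L s * D n s) (t := Metric.ball (0 : ℝ) (|t| + 1)) (y₀ := t) (y := t)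
        ((hs _).mul_left C) Metric.isOpen_ball (convex_ball _ _).isPreconnected
        (fun n s _ => Dd n s) (fun n s hs' => ?_) hr
        ((summable_nat_add_iff 1).2 (hsum t)) hr
    · have e : (fun t => ∑' n, D n t) = fun t => 1 + ∑' n, D (n + 1) t := by
        funext s
        rw [(hsum s).tsum_eq_zero_add, D0]
      rw [(hsum t).tsum_mul_left] at h
      rw [e]
      have e' : (∑' n, D n t) = 1 + ∑' n, D (n + 1) t := congrFun e t
      simpa only [e'] using h.const_add 1
    · have hs'' : |s| ≤ |t| + 1 := by
        have := Metric.mem_ball.1 hs'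
        rw [Real.dist_eq, sub_zero] at this
        exact this.le
      refine (norm_mul_le _ _).trans ?_
      gcongr
      · exact hC s
      · refine (Db n s).trans ?_
        gcongr

/-- Uniqueness on the whole line for an equation with uniformly Lipschitz right-hand side. -/
theorem eq_of_hasDerivAt_of_lipschitz {E : Type*} [NormedAddCommGroup E] [NormedSpace ℝ E]
    (v : ℝ → E → E) {C : ℝ} (hv : ∀ t x y, ‖v t x - v t y‖ ≤ C * ‖x - y‖)
    {f g : ℝ → E} (hf : ∀ t, HasDerivAt f (v t (f t)) t) (hg : ∀ t, HasDerivAt g (v t (g t)) t)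
    (h0 : f 0 = g 0) : f = g := by
  have hl : ∀ t, LipschitzWith C.toNNReal (v t) := fun t =>
    LipschitzWith.of_dist_le_mul fun x y => by
      rw [dist_eq_norm, dist_eq_norm]
      refine (hv t x y).trans ?_
      gcongr
      exact Real.le_coe_toNNReal C
  exact ODE_solution_unique_univ (s := fun _ => Set.univ) (fun t => (hl t).lipschitzOnWith)
    (fun t => ⟨hf t, trivial⟩) (fun t => ⟨hg t, trivial⟩) h0

/-! ### Operator-valued evolutions and the averaged dynamics -/

section Operators

variable {H : Type*} [NormedAddCommGroup H] [InnerProductSpace ℂ H]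

theorem HasDerivAt.clm_apply_const {V : ℝ → H →L[ℂ] H} {V' : H →L[ℂ] H} {t : ℝ}
    (h : HasDerivAt V V' t) (x : H) : HasDerivAt (fun s => V s x) (V' x) t :=
  ((ContinuousLinearMap.apply ℂ H x).restrictScalars ℝ).hasFDerivAt.comp_hasDerivAt t h

theorem HasDerivAt.const_clm_apply {f : ℝ → H} {f' : H} {t : ℝ}
    (h : HasDerivAt f f' t) (T : H →L[ℂ] H) : HasDerivAt (fun s => T (f s)) (T f') t :=
  (T.restrictScalars ℝ).hasFDerivAt.comp_hasDerivAt t h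

theorem hasDerivAt_re_inner {f g : ℝ → H} {f' g' : H} {t : ℝ} (hf : HasDerivAt f f' t)
    (hg : HasDerivAt g g' t) : HasDerivAt (fun s => (inner ℂ (f s) (g s)).re)
      ((inner ℂ (f t) g').re + (inner ℂ f' (g t)).re) t := by
  have := Complex.reCLM.hasFDerivAt.comp_hasDerivAt t (hf.inner ℂ hg)
  exact this.congr_deriv (by simp)

theorem re_inner_self (x : H) : (inner ℂ x x).re = ‖x‖ ^ 2 :=
  inner_self_eq_norm_sq (𝕜 := ℂ) x

variable [CompleteSpace H]

/-- A skew-adjoint generator produces unitary operators. `V* V` has zero derivative, whereas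
`V V*` is only seen to solve `X' = [L, X]`, and equals the solution `1` by uniqueness. -/
theorem mem_unitary_of_hasDerivAt {L V : ℝ → H →L[ℂ] H} {C : ℝ} (hC : ∀ t, ‖L t‖ ≤ C)
    (hL : ∀ t, star (L t) = -L t) (hV0 : V 0 = 1) (hV : ∀ t, HasDerivAt V (L t * V t) t) (t : ℝ) :
    V t ∈ unitary (H →L[ℂ] H) := by
  have hVs : ∀ t, HasDerivAt (fun s => star (V s)) (star (V t) * -L t) t := fun t => by
    have := (hV t).star
    rwa [star_mul, hL] at this
  have h1 : ∀ t, HasDerivAt (fun s => star (V s) * V s) 0 t := fun t => by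
    refine ((hVs t).mul (hV t)).congr_deriv ?_
    noncomm_ring
  have h2 : (fun s => V s * star (V s)) = fun _ => 1 := by
    refine eq_of_hasDerivAt_of_lipschitz (fun t X => L t * X - X * L t) (C := C + C)
      (fun t X Y => ?_) (fun t => ?_) (fun t => ?_) (by simp [hV0])
    · calc _ = ‖L t * (X - Y) - (X - Y) * L t‖ := by congr 1; noncomm_ring
        _ ≤ ‖L t‖ * ‖X - Y‖ + ‖X - Y‖ * ‖L t‖ :=
          (norm_sub_le _ _).trans (add_le_add (norm_mul_le _ _) (norm_mul_le _ _))
        _ ≤ C * ‖X - Y‖ + ‖X - Y‖ * C := by gcongr <;> exact hC t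
        _ = _ := by ring
    · refine ((hV t).mul (hVs t)).congr_deriv ?_
      noncomm_ring
    · refine (hasDerivAt_const t (1 : H →L[ℂ] H)).congr_deriv ?_
      simp
  refine Unitary.mem_iff.2 ⟨?_, congrFun h2 t⟩
  have := is_const_of_deriv_eq_zero (fun t => (h1 t).differentiableAt) (fun t => (h1 t).deriv) t 0
  simpa [hV0] using this

theorem re_inner_apply_self_of_star_eq_neg {K : H →L[ℂ] H} (hK : star K = -K) (x : H) :
    (inner ℂ x (K x)).re = 0 := by
  have h : inner ℂ x (K x) = -inner ℂ (K x) x := by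
    rw [← ContinuousLinearMap.adjoint_inner_left, ← ContinuousLinearMap.star_eq_adjoint, hK,
      neg_apply, inner_neg_left]
  have h2 : (inner ℂ x (K x)).re = (inner ℂ (K x) x).re := inner_re_symm (𝕜 := ℂ) x (K x)
  rw [h, Complex.neg_re] at h2 ⊢
  linarith

theorem norm_eq_of_hasDerivAt_skew {K : H →L[ℂ] H} (hK : star K = -K) {y : ℝ → H}
    (hy : ∀ t, HasDerivAt y (K (y t)) t) (t : ℝ) : ‖y t‖ = ‖y 0‖ := by
  have h : ∀ t, HasDerivAt (fun s => (inner ℂ (y s) (y s)).re) 0 t := fun t => by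
    refine (hasDerivAt_re_inner (hy t) (hy t)).congr_deriv ?_
    have h2 : (inner ℂ (y t) (K (y t))).re = (inner ℂ (K (y t)) (y t)).re :=
      inner_re_symm (𝕜 := ℂ) _ _
    rw [← h2, re_inner_apply_self_of_star_eq_neg hK, add_zero]
  have := is_const_of_deriv_eq_zero (fun t => (h t).differentiableAt) (fun t => (h t).deriv) t 0
  simp only [re_inner_self] at this
  exact (pow_left_inj₀ (norm_nonneg _) (norm_nonneg _) two_ne_zero).1 this

/-- Ballistic growth of the averaged dynamics on the half-line. Here `S` is a shift, `R` the inverse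
of the number operator and `1 - S S*` the projection onto the ground state `e`. With `K = S - S*`
and `C = S + S*` the generator is `K + C R`, and `y = R z` solves `y' = K y`. The boundary terms in
the second derivative of `‖z‖²` cancel: half of it is `‖C y‖² + 2 ⟪y, P y⟫`, where `P = 1 - S S*`,
while the parallelogram law and the conservation of `‖y‖` and `‖K y‖` give
`‖C y‖² = 3 - 2 ⟪y, P y⟫`. -/
theorem norm_sq_eq_one_add_three_mul_sq {S R : H →L[ℂ] H} (hS : star S * S = 1)
    (hR : star R = R) (hRS : R * S * (1 + R) = S * R)
    (hP : R * (1 - S * star S) = 1 - S * star S) {e : H} (he : ‖e‖ = 1) (hRe : R e = e)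
    (hSe : star S e = 0) {z : ℝ → H} (hz0 : z 0 = e)
    (hz : ∀ t, HasDerivAt z ((S * (1 + R) - star S * (1 - R)) (z t)) t) (t : ℝ) :
    ‖z t‖ ^ 2 = 1 + 3 * t ^ 2 := by
  have hSR : R * star S * (1 - R) = star S * R := by
    have h := congrArg star hRS
    simp only [star_mul, star_add, star_one, hR] at h
    rw [mul_sub, mul_one, sub_eq_iff_eq_add, mul_assoc, ← h]
    noncomm_ring
  set K := S - star S with hKdef
  set C := S + star S with hCdef
  have hK : star K = -K := by simp [hKdef]
  have hC : star C = C := by simp [hCdef, add_comm]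
  have hK1 : S * (1 + R) - star S * (1 - R) = K + C * R := by
    rw [hKdef, hCdef]; noncomm_ring
  have hRK : R * (K + C * R) = K * R := by
    rw [← hK1, mul_sub, ← mul_assoc, ← mul_assoc, hRS, hSR, hKdef, sub_mul]
  rw [hK1] at hz
  have adj : ∀ (T : H →L[ℂ] H) (x y : H), inner ℂ (T x) y = inner ℂ x (star T y) := fun T x y => by
    rw [ContinuousLinearMap.star_eq_adjoint, ContinuousLinearMap.adjoint_inner_right]
  -- the evolution in the original picture
  set y : ℝ → H := fun t => R (z t) with hydef
  have hy : ∀ t, HasDerivAt y (K (y t)) t := fun t => by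
    have := (hz t).const_clm_apply R
    rwa [← mul_apply_eq_comp, hRK] at this
  have hy0 : y 0 = e := by simp only [hydef, hz0, hRe]
  have hyn : ∀ t, ‖y t‖ = 1 := fun t => by rw [norm_eq_of_hasDerivAt_skew hK hy t, hy0, he]
  have isoS : ∀ x, ‖S x‖ ^ 2 = ‖x‖ ^ 2 := fun x => by
    rw [← re_inner_self, adj, ← mul_apply_eq_comp, hS, one_apply_eq_self,
      re_inner_self]
  have hKn : ∀ t, ‖K (y t)‖ ^ 2 = 1 := fun t => by
    rw [norm_eq_of_hasDerivAt_skew hK (fun t => (hy t).const_clm_apply K) t, hy0, hKdef,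
      sub_apply, hSe, sub_zero, isoS, he, one_pow]
  set P := 1 - S * star S with hPdef
  have hSs : ∀ x, ‖star S x‖ ^ 2 = ‖x‖ ^ 2 - (inner ℂ x (P x)).re := fun x => by
    rw [← re_inner_self, adj, star_star, ← mul_apply_eq_comp, hPdef,
      sub_apply, inner_sub_right, one_apply_eq_self,
      Complex.sub_re, re_inner_self]
    ring
  have hCn : ∀ t, ‖C (y t)‖ ^ 2 = 3 - 2 * (inner ℂ (y t) (P (y t))).re := fun t => by
    have h := parallelogram_law_with_norm ℂ (S (y t)) (star S (y t))
    rw [← add_apply, ← sub_apply, ← hKdef, ← hCdef] at h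
    have h1 := hKn t
    have h2 := isoS (y t)
    have h3 := hSs (y t)
    rw [hyn] at h2 h3
    nlinarith
  -- The commutator lives on the ground state because `S` is an isometry.
  have hcomm : C * K - K * C = 2 * P := by
    have : C * K - K * C = 2 * (star S * S - S * star S) := by
      rw [hCdef, hKdef]; noncomm_ring
    rw [this, hS]
  have hG : ∀ t, HasDerivAt (fun s => (inner ℂ (z s) (C (y s))).re) 3 t := fun t => by
    refine (hasDerivAt_re_inner (hz t) ((hy t).const_clm_apply C)).congr_deriv ?_
    have e1 : inner ℂ ((K + C * R) (z t)) (C (y t)) =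
        -inner ℂ (z t) ((K * C) (y t)) + inner ℂ (C (y t)) (C (y t)) := by
      rw [add_apply, inner_add_left, adj K, hK, neg_apply,
        inner_neg_right]
      rfl
    have e2 : inner ℂ (z t) (C (K (y t))) =
        inner ℂ (z t) ((K * C) (y t)) + 2 * inner ℂ (y t) (P (y t)) := by
      -- `R P = P` makes it possible to move `R` to the other side, turning `z` into `y = R z`.
      have : C (K (y t)) = (K * C) (y t) + (2 : ℂ) • R (P (y t)) := by
        rw [← mul_apply_eq_comp R P, hP, ← mul_apply_eq_comp,
          eq_add_of_sub_eq hcomm, add_comm, add_apply, two_mul, two_smul,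
          add_apply]
      rw [this, inner_add_right, inner_smul_right]
      congr 2
      conv_lhs => rw [← hR]
      rw [← adj]
    rw [e1, e2, Complex.add_re, Complex.add_re, Complex.neg_re, re_inner_self, hCn]
    simp
    ring
  have hG' : ∀ t, (inner ℂ (z t) (C (y t))).re = 3 * t := fun t => by
    have h : ∀ t, HasDerivAt (fun s => (inner ℂ (z s) (C (y s))).re - 3 * s) 0 t := fun t => by
      refine ((hG t).sub ((hasDerivAt_id t).const_mul 3)).congr_deriv ?_
      simp
    have := is_const_of_deriv_eq_zero (fun t => (h t).differentiableAt) (fun t => (h t).deriv) t 0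
    have h0 : inner ℂ e (C e) = 0 := by
      rw [hCdef, add_apply, hSe, add_zero, ← star_star S, ← adj, hSe, inner_zero_left]
    simp only [hz0, hy0, h0, Complex.zero_re] at this
    linarith
  have hF : ∀ t, HasDerivAt (fun s => (inner ℂ (z s) (z s)).re) (6 * t) t := fun t => by
    refine (hasDerivAt_re_inner (hz t) (hz t)).congr_deriv ?_
    have h2 : (inner ℂ ((K + C * R) (z t)) (z t)).re = (inner ℂ (z t) ((K + C * R) (z t))).re :=
      inner_re_symm (𝕜 := ℂ) _ _
    have h3 : (C * R) (z t) = C (y t) := rfl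
    rw [h2, add_apply, inner_add_right, Complex.add_re, h3, hG',
      re_inner_apply_self_of_star_eq_neg hK]
    ring
  have h : ∀ t, HasDerivAt (fun s => (inner ℂ (z s) (z s)).re - 3 * s ^ 2) 0 t := fun t => by
    refine ((hF t).sub ((hasDerivAt_pow 2 t).const_mul 3)).congr_deriv ?_
    simp
    ring
  have := is_const_of_deriv_eq_zero (fun t => (h t).differentiableAt) (fun t => (h t).deriv) t 0
  simp only [hz0, re_inner_self, he] at this
  linarith

end Operators

/-! ### Averaging of the resonant drive -/

section Averaging

variable {H : Type*} [NormedAddCommGroup H] [InnerProductSpace ℂ H]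

theorem HasDerivAt.complex_clm_apply {V : ℝ → H →L[ℂ] H} {V' : H →L[ℂ] H} {f : ℝ → H} {f' : H}
    {t : ℝ} (hV : HasDerivAt V V' t) (hf : HasDerivAt f f' t) :
    HasDerivAt (fun s => V s (f s)) (V' (f t) + V t f') t :=
  ((ContinuousLinearMap.restrictScalarsL ℂ H H ℝ ℝ).hasFDerivAt.comp_hasDerivAt t hV).clm_apply hf

/-- First-order averaging: if `M - D` has a bounded primitive `G`, solutions of `x' = ε M x` follow
the solution of `z' = D z` with slow time `ε t`, up to an error `O(ε)` at slow time `τ`. The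
constant does not depend on `ε` nor on `x`. -/
theorem exists_norm_sub_le_of_averaging {M G : ℝ → H →L[ℂ] H} {D : H →L[ℂ] H} {m g : ℝ}
    (hm : 0 < m) (hM : ∀ t, ‖M t‖ ≤ m) (hG : ∀ t, ‖G t‖ ≤ g)
    (hGM : ∀ t, HasDerivAt G (M t - D) t) {z : ℝ → H} (hz : ∀ s, HasDerivAt z (D (z s)) s)
    {τ Y : ℝ} (hτ : 0 ≤ τ) (hY : ∀ s ∈ Set.Icc 0 τ, ‖z s‖ ≤ Y) :
    ∃ C : ℝ, ∀ ε : ℝ, 0 < ε → ∀ x : ℝ → H, x 0 = z 0 → (∀ t, HasDerivAt x ((ε : ℂ) • M t (x t)) t) →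
      ‖x (τ / ε) - z τ‖ ≤ ε * C := by
  have hY0 : 0 ≤ Y := (norm_nonneg _).trans (hY 0 ⟨le_rfl, hτ⟩)
  have hg0 : 0 ≤ g := (norm_nonneg _).trans (hG 0)
  refine ⟨g * Y * Real.exp (m * τ) +
    ((g * (‖D‖ * Y) + m * (g * Y)) / m * (Real.exp (m * τ) - 1)) + g * Y, ?_⟩
  intro ε hε x hx0 hx
  have hy : ∀ t, HasDerivAt (fun t => z (ε * t)) ((ε : ℂ) • D (z (ε * t))) t := fun t => by
    have h := (hz (ε * t)).scomp t ((hasDerivAt_id t).const_mul ε)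
    refine h.congr_deriv ?_
    rw [mul_one, Complex.coe_smul]
  have hεn : ‖(ε : ℂ)‖ = ε := by simp [abs_of_pos hε]
  -- The corrector `ε G` cancels the oscillating terms of order `ε`; what is left is of order `ε²`
  -- over a time of order `1 / ε`.
  set f : ℝ → H := fun t => x t - (z (ε * t) + (ε : ℂ) • G t (z (ε * t))) with hf
  have hf' : ∀ t, HasDerivAt f ((ε : ℂ) • M t (f t) + ((ε : ℂ) * ε) •
      (M t (G t (z (ε * t))) - G t (D (z (ε * t))))) t := fun t => by
    refine ((hx t).sub ((hy t).add
      (((hGM t).complex_clm_apply (hy t)).const_smul (ε : ℂ)))).congr_deriv ?_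
    simp only [hf, map_sub, map_add, map_smul, sub_apply, smul_sub, smul_add, smul_smul]
    abel
  have hmem : ∀ t ∈ Set.Icc 0 (τ / ε), ε * t ∈ Set.Icc 0 τ := fun t ht =>
    ⟨mul_nonneg hε.le ht.1, by rw [mul_comm]; exact (le_div_iff₀ hε).1 ht.2⟩
  have hGz : ∀ t ∈ Set.Icc 0 (τ / ε), ‖G t (z (ε * t))‖ ≤ g * Y := fun t ht =>
    ((G t).le_opNorm _).trans
      (mul_le_mul (hG t) (hY _ (hmem t ht)) (norm_nonneg _) hg0)
  have hT : (0 : ℝ) ≤ τ / ε := by positivity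
  have h0 : ‖f 0‖ ≤ ε * (g * Y) := by
    have : f 0 = -((ε : ℂ) • G 0 (z (ε * 0))) := by
      simp only [hf, hx0, mul_zero]; abel
    rw [this, norm_neg, norm_smul, hεn]
    gcongr
    exact hGz 0 ⟨le_rfl, hT⟩
  have hb : ∀ t ∈ Set.Ico 0 (τ / ε), ‖(ε : ℂ) • M t (f t) + ((ε : ℂ) * ε) •
      (M t (G t (z (ε * t))) - G t (D (z (ε * t))))‖ ≤
      (ε * m) * ‖f t‖ + ε * ε * (g * (‖D‖ * Y) + m * (g * Y)) := fun t ht => by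
    have ht' := Set.Ico_subset_Icc_self ht
    refine (norm_add_le _ _).trans (add_le_add ?_ ?_)
    · rw [norm_smul, hεn, mul_assoc]
      gcongr
      exact (M t).le_of_opNorm_le (hM t) _
    · rw [norm_smul, norm_mul, hεn]
      gcongr
      refine (norm_sub_le _ _).trans ((add_comm _ _).le.trans (add_le_add ?_ ?_))
      · refine ((G t).le_of_opNorm_le (hG t) _).trans ?_
        gcongr
        refine (D.le_opNorm _).trans ?_
        gcongr
        exact hY _ (hmem t ht')
      · refine ((M t).le_of_opNorm_le (hM t) _).trans ?_
        gcongr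
        exact hGz t ht'
  have key := norm_le_gronwallBound_of_norm_deriv_right_le
    (fun t _ => (hf' t).continuousAt.continuousWithinAt)
    (fun t _ => (hf' t).hasDerivWithinAt) h0 hb (τ / ε) ⟨hT, le_rfl⟩
  rw [gronwallBound_of_K_ne_0 (by positivity), sub_zero] at key
  have e1 : ε * m * (τ / ε) = m * τ := by field_simp
  have e2 : ε * (τ / ε) = τ := by field_simp
  dsimp only at key
  rw [e1] at key
  have hlast := hGz (τ / ε) ⟨hT, le_rfl⟩
  simp only [hf, e2] at key hlast
  calc ‖x (τ / ε) - z τ‖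
      = ‖(x (τ / ε) - (z τ + (ε : ℂ) • G (τ / ε) (z τ))) + (ε : ℂ) • G (τ / ε) (z τ)‖ := by
        congr 1; abel
    _ ≤ _ := norm_add_le _ _
    _ ≤ _ + ε * (g * Y) := add_le_add key (by rw [norm_smul, hεn]; gcongr)
    _ = _ := by field_simp

/-- The operator `-i sin t (e^{it} P + e^{-it} Q)`: for `P = S` and `Q = S*` with `S` raising the
energy by one, it is `sin t` times the coupling `-i (S + S*)` seen in the interaction picture. -/
noncomputable def resonantDrive (P Q : H →L[ℂ] H) (t : ℝ) : H →L[ℂ] H :=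
  (-(Complex.I * Complex.sin t)) •
    (Complex.exp (t * Complex.I) • P + Complex.exp (-t * Complex.I) • Q)

theorem norm_resonantDrive_le (P Q : H →L[ℂ] H) (t : ℝ) : ‖resonantDrive P Q t‖ ≤ ‖P‖ + ‖Q‖ := by
  have h1 : ‖Complex.sin t‖ ≤ 1 := by
    rw [← Complex.ofReal_sin, Complex.norm_real]; exact Real.abs_sin_le_one t
  have h2 : ‖Complex.exp (-t * Complex.I)‖ = 1 := by
    rw [← Complex.ofReal_neg]; exact Complex.norm_exp_ofReal_mul_I _
  have h3 := Complex.norm_exp_ofReal_mul_I t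
  rw [resonantDrive, norm_smul, norm_neg, norm_mul, Complex.norm_I, one_mul]
  calc _ ≤ 1 * ‖Complex.exp (t * Complex.I) • P + Complex.exp (-t * Complex.I) • Q‖ := by gcongr
    _ ≤ _ := by
      rw [one_mul]
      refine (norm_add_le _ _).trans ?_
      rw [norm_smul, norm_smul, h2, h3, one_mul, one_mul]

theorem continuous_resonantDrive (P Q : H →L[ℂ] H) : Continuous (resonantDrive P Q) := by
  unfold resonantDrive
  fun_prop

/-- The drive has mean `(P - Q) / 2`, and its oscillating part `-(e^{2it} P - e^{-2it} Q) / 2` has a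
bounded primitive. -/
theorem exists_primitive_resonantDrive (P Q : H →L[ℂ] H) :
    ∃ G : ℝ → H →L[ℂ] H, (∃ g, ∀ t, ‖G t‖ ≤ g) ∧
      ∀ t, HasDerivAt G (resonantDrive P Q t - (1 / 2 : ℂ) • (P - Q)) t := by
  have hd : ∀ (c : ℂ) (t : ℝ), HasDerivAt (fun s : ℝ => Complex.exp (s * c))
      (c * Complex.exp (t * c)) t := fun c t => by
    have h := ((Complex.ofRealCLM.hasDerivAt (x := t)).mul_const c).cexp
    refine h.congr_deriv ?_
    simp [mul_comm]
  refine ⟨fun t => (Complex.I / 4) • (Complex.exp (t * (2 * Complex.I)) • P +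
    Complex.exp (t * (-(2 * Complex.I))) • Q), ⟨‖P‖ + ‖Q‖, fun t => ?_⟩, fun t => ?_⟩
  · have h2 : ‖Complex.exp (t * (-(2 * Complex.I)))‖ = 1 := by
      rw [← Complex.norm_exp_ofReal_mul_I (-(t * 2))]; congr 2; push_cast; ring
    have h3 : ‖Complex.exp (t * (2 * Complex.I))‖ = 1 := by
      rw [← Complex.norm_exp_ofReal_mul_I (t * 2)]; congr 2; push_cast; ring
    have h4 : ‖Complex.I / 4‖ ≤ 1 := by simp; norm_num
    rw [norm_smul]
    calc _ ≤ 1 * ‖_‖ := by gcongr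
      _ ≤ _ := by
        rw [one_mul]
        refine (norm_add_le _ _).trans ?_
        rw [norm_smul, norm_smul, h2, h3, one_mul, one_mul]
  · refine ((((hd (2 * Complex.I) t).smul_const P).add
      ((hd (-(2 * Complex.I)) t).smul_const Q)).const_smul (Complex.I / 4)).congr_deriv ?_
    have hI := Complex.I_sq
    have e1 : Complex.exp (t * (2 * Complex.I)) =
        Complex.exp (t * Complex.I) * Complex.exp (t * Complex.I) := by
      rw [← Complex.exp_add]; congr 1; ring
    have e2 : Complex.exp (t * (-(2 * Complex.I))) =
        Complex.exp (-t * Complex.I) * Complex.exp (-t * Complex.I) := by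
      rw [← Complex.exp_add]; congr 1; ring
    have e3 : Complex.exp (t * Complex.I) * Complex.exp (-t * Complex.I) = 1 := by
      rw [← Complex.exp_add]; simp
    rw [resonantDrive, Complex.sin, e1, e2]
    set a := Complex.exp (t * Complex.I)
    set b := Complex.exp (-t * Complex.I)
    have c1 : -(Complex.I * ((b - a) * Complex.I / 2)) * a = 1 / 2 - 1 / 2 * (a * a) := by
      linear_combination (-(b - a) / 2 * a) * hI + 1 / 2 * e3
    have c2 : -(Complex.I * ((b - a) * Complex.I / 2)) * b = 1 / 2 * (b * b) - 1 / 2 := by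
      linear_combination (-(b - a) / 2 * b) * hI - 1 / 2 * e3
    have c3 : Complex.I / 4 * (2 * Complex.I * (a * a)) = -(1 / 2 * (a * a)) := by
      linear_combination (1 / 2 * (a * a)) * hI
    have c4 : Complex.I / 4 * (-(2 * Complex.I) * (b * b)) = 1 / 2 * (b * b) := by
      linear_combination (-1 / 2 * (b * b)) * hI
    rw [smul_add, smul_add, smul_smul, smul_smul, smul_smul, smul_smul, c1, c2, c3, c4]
    module

theorem star_resonantDrive [CompleteSpace H] (S : H →L[ℂ] H) (t : ℝ) :
    star (resonantDrive S (star S) t) = -resonantDrive S (star S) t := by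
  have hs : star (Complex.sin t) = Complex.sin t := by
    rw [← Complex.ofReal_sin]; exact Complex.conj_ofReal _
  have he : ∀ t : ℝ, star (Complex.exp (t * Complex.I)) = Complex.exp (-t * Complex.I) := by
    intro t
    change (starRingEnd ℂ) _ = _
    rw [← Complex.exp_conj]
    simp
  have he' : star (Complex.exp (-t * Complex.I)) = Complex.exp (t * Complex.I) := by
    simpa using he (-t)
  have hI : star Complex.I = -Complex.I := Complex.conj_I
  rw [resonantDrive, star_smul, star_add, star_smul, star_smul, star_star, he, he', star_neg,
    star_mul, hs, hI]
  module

/-- A weak resonant drive lifts the ground state to energy `M` within time `2 M / ε`. -/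
theorem exists_le_norm_of_hasDerivAt_resonantDrive [CompleteSpace H] {S R : H →L[ℂ] H}
    (hS : star S * S = 1) (hR : star R = R) (hRS : R * S * (1 + R) = S * R)
    (hP : R * (1 - S * star S) = 1 - S * star S) {e : H} (he : ‖e‖ = 1) (hRe : R e = e)
    (hSe : star S e = 0) {M : ℝ} (hM : 0 < M) :
    ∃ ε : ℝ, 0 < ε ∧ ∀ x : ℝ → H, x 0 = e →
      (∀ t, HasDerivAt x
        ((ε : ℂ) • resonantDrive (S * (1 + R)) (star S * (1 - R)) t (x t)) t) →
      M ≤ ‖x (2 * M / ε)‖ := by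
  set P := S * (1 + R) with hPdef
  set Q := star S * (1 - R) with hQdef
  obtain ⟨V, hV0, hV⟩ := exists_hasDerivAt_mul (fun _ => P - Q) continuous_const
    (C := ‖P - Q‖) fun _ => le_rfl
  have hVe : ∀ t, HasDerivAt (fun s => V s e) ((P - Q) (V t e)) t := fun t =>
    (hV t).clm_apply_const e
  have hn := norm_sq_eq_one_add_three_mul_sq hS hR hRS hP he hRe hSe (z := fun s => V s e)
    (by simp [hV0]) hVe
  have hz : ∀ s, HasDerivAt (fun s => V (s / 2) e)
      (((1 / 2 : ℂ) • (P - Q)) (V (s / 2) e)) s := fun s => by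
    have h := (hVe (s / 2)).scomp s ((hasDerivAt_id s).div_const 2)
    refine h.congr_deriv ?_
    rw [← Complex.coe_smul]
    norm_num
  obtain ⟨G, ⟨g, hg⟩, hG⟩ := exists_primitive_resonantDrive P Q
  have hY : ∀ s ∈ Set.Icc 0 (2 * M), ‖V (s / 2) e‖ ≤ 1 + 3 * M ^ 2 := fun s hs => by
    have h1 := hn (s / 2)
    have h2 : (s / 2) ^ 2 ≤ M ^ 2 := by
      have := hs.1
      have := hs.2
      gcongr
      linarith
    have h3 : 0 ≤ M ^ 2 := sq_nonneg M
    nlinarith [norm_nonneg (V (s / 2) e)]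
  obtain ⟨C, hC⟩ := exists_norm_sub_le_of_averaging (m := ‖P‖ + ‖Q‖ + 1) (by positivity)
    (fun t => (norm_resonantDrive_le P Q t).trans (by linarith)) hg hG hz (by positivity) hY
  have hlt : M < ‖V M e‖ := by
    have h1 := hn M
    have h3 : 0 ≤ M ^ 2 := sq_nonneg M
    nlinarith [norm_nonneg (V M e)]
  obtain ⟨ε, hε, hεC⟩ : ∃ ε : ℝ, 0 < ε ∧ ε * C ≤ ‖V M e‖ - M := by
    refine ⟨(‖V M e‖ - M) / (|C| + 1), div_pos (sub_pos.2 hlt) (by positivity), ?_⟩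
    rw [div_mul_eq_mul_div, div_le_iff₀ (by positivity)]
    have := le_abs_self C
    nlinarith
  refine ⟨ε, hε, fun x hx0 hx => ?_⟩
  have h := hC ε hε x (by simp [hx0, hV0]) hx
  rw [mul_div_cancel_left₀ M two_ne_zero] at h
  have h2 := norm_sub_norm_le (V M e) (x (2 * M / ε))
  rw [norm_sub_rev] at h2
  linarith

end Averaging

/-! ### The number operator, shifts and free evolution on `ℓ²(ℕ+)` -/

/-- The Hilbert space `ℓ²(ℕ+)`, whose standard basis vectors are the energy levels. -/
abbrev EllTwo : Type := lp (fun _ : ℕ+ => ℂ) 2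

namespace EllTwo

theorem summable_norm_sq (x : EllTwo) : Summable fun k => ‖x k‖ ^ 2 := by
  simpa using (lp.memℓp x).summable (by simp)

theorem norm_sq_eq_tsum (x : EllTwo) : ‖x‖ ^ 2 = ∑' k, ‖x k‖ ^ 2 := by
  simpa using lp.norm_rpow_eq_tsum (p := 2) (by simp) x

theorem summable_norm_sq_weightedComp {c : ℕ+ → ℂ} {σ : ℕ+ → ℕ+} (hσ : Function.Injective σ)
    {C : ℝ} (hc : ∀ k, ‖c k‖ ≤ C) (x : EllTwo) : Summable fun k => ‖c k * x (σ k)‖ ^ 2 := by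
  refine Summable.of_nonneg_of_le (fun _ => by positivity) (fun k => ?_)
    (((summable_norm_sq x).comp_injective hσ).mul_left (C ^ 2))
  rw [norm_mul, mul_pow]
  have := hc k
  simp only [Function.comp]
  gcongr

/-- The bounded operator `(x_k) ↦ (c_k x_{σ k})` on `ℓ²(ℕ+)`, for bounded weights and injective `σ`.
It covers both diagonal operators and the backward shift. -/
noncomputable def weightedComp (c : ℕ+ → ℂ) (σ : ℕ+ → ℕ+) (hσ : Function.Injective σ) (C : ℝ)
    (hc : ∀ k, ‖c k‖ ≤ C) : EllTwo →L[ℂ] EllTwo :=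
  LinearMap.mkContinuous
    { toFun := fun x => ⟨fun k => c k * x (σ k),
        memℓp_gen (by simpa using summable_norm_sq_weightedComp hσ hc x)⟩
      map_add' := fun x y => lp.ext (funext fun k => mul_add (c k) (x (σ k)) (y (σ k)))
      map_smul' := fun a x => lp.ext (funext fun k => mul_left_comm (c k) a (x (σ k))) } C (by
    intro x
    have hC : 0 ≤ C := (norm_nonneg _).trans (hc 1)
    refine (pow_le_pow_iff_left₀ (norm_nonneg _) (by positivity) two_ne_zero).1 ?_
    rw [mul_pow, norm_sq_eq_tsum, norm_sq_eq_tsum x, ← tsum_mul_left]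
    refine Summable.tsum_le_tsum_of_inj σ hσ (fun _ _ => by positivity) (fun k => ?_)
      (summable_norm_sq_weightedComp hσ hc x) ((summable_norm_sq x).mul_left _)
    change ‖c k * x (σ k)‖ ^ 2 ≤ _
    rw [norm_mul, mul_pow]
    have := hc k
    gcongr)

section

variable {c : ℕ+ → ℂ} {σ : ℕ+ → ℕ+} {hσ : Function.Injective σ} {C : ℝ} {hc : ∀ k, ‖c k‖ ≤ C}

@[simp]
theorem weightedComp_apply (x : EllTwo) (k : ℕ+) :
    weightedComp c σ hσ C hc x k = c k * x (σ k) := rfl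

theorem norm_weightedComp_le : ‖weightedComp c σ hσ C hc‖ ≤ C :=
  LinearMap.mkContinuous_norm_le _ ((norm_nonneg _).trans (hc 1)) _

end

theorem star_weightedComp_id {c d : ℕ+ → ℂ} {C D : ℝ} (hc : ∀ k, ‖c k‖ ≤ C) (hd : ∀ k, ‖d k‖ ≤ D)
    (h : ∀ k, d k = starRingEnd ℂ (c k)) :
    star (weightedComp c id Function.injective_id C hc) =
      weightedComp d id Function.injective_id D hd := by
  rw [ContinuousLinearMap.star_eq_adjoint, eq_comm, ContinuousLinearMap.eq_adjoint_iff]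
  intro x y
  rw [lp.inner_eq_tsum, lp.inner_eq_tsum]
  refine tsum_congr fun k => ?_
  simp only [weightedComp_apply, RCLike.inner_apply, h, map_mul, id, Complex.conj_conj]
  ring

/-- The `k`-th standard basis vector. -/
noncomputable def basisVec (k : ℕ+) : EllTwo := lp.single 2 k (1 : ℂ)

theorem basisVec_apply (k j : ℕ+) : basisVec k j = if j = k then 1 else 0 := by
  rw [basisVec, lp.single_apply, Pi.single_apply]

theorem add_one_ne_one (k : ℕ+) : k + 1 ≠ 1 := (PNat.lt_add_left 1 k).ne'

theorem inner_basisVec (k : ℕ+) (x : EllTwo) : inner ℂ (basisVec k) x = x k := by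
  rw [basisVec, lp.inner_single_left]
  simp

theorem norm_basisVec (k : ℕ+) : ‖basisVec k‖ = 1 := by
  rw [basisVec, lp.norm_single (by simp), norm_one]

/-- The backward shift, `e_{k+1} ↦ e_k` and `e_1 ↦ 0`. -/
noncomputable def lower : EllTwo →L[ℂ] EllTwo :=
  weightedComp (fun _ => 1) (fun k => k + 1) (add_left_injective 1) 1 (by simp)

/-- The forward shift `e_k ↦ e_{k+1}`, defined as the adjoint of the backward one. -/
noncomputable def raise : EllTwo →L[ℂ] EllTwo := star lower

@[simp]
theorem lower_apply (x : EllTwo) (k : ℕ+) : lower x k = x (k + 1) := by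
  simp [lower]

theorem raise_apply (x : EllTwo) (k : ℕ+) : raise x k = inner ℂ (lower (basisVec k)) x := by
  rw [← inner_basisVec, raise, ContinuousLinearMap.star_eq_adjoint,
    ContinuousLinearMap.adjoint_inner_right]

@[simp]
theorem raise_apply_one (x : EllTwo) : raise x 1 = 0 := by
  have : lower (basisVec 1) = 0 := lp.ext (funext fun k => by
    rw [lower_apply, basisVec_apply, if_neg (add_one_ne_one k)]; rfl)
  rw [raise_apply, this, inner_zero_left]

@[simp]
theorem raise_apply_add_one (x : EllTwo) (k : ℕ+) : raise x (k + 1) = x k := by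
  have : lower (basisVec (k + 1)) = basisVec k := lp.ext (funext fun j => by
    rw [lower_apply, basisVec_apply, basisVec_apply]
    simp)
  rw [raise_apply, this, inner_basisVec]

/-- The inverse `R = diag (1 / k)` of the number operator `N = diag k`. -/
noncomputable def invNumber : EllTwo →L[ℂ] EllTwo :=
  weightedComp (fun k => ((k : ℕ) : ℂ)⁻¹) id Function.injective_id 1 (fun k => by
    rw [norm_inv, Complex.norm_natCast]
    exact inv_le_one_of_one_le₀ (by exact Nat.one_le_cast.2 k.pos))

@[simp]
theorem invNumber_apply (x : EllTwo) (k : ℕ+) : invNumber x k = ((k : ℕ) : ℂ)⁻¹ * x k := rfl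

/-- The group `exp (t A) = diag (e^{-itk})` generated by the drift. -/
noncomputable def freeEvolution (t : ℝ) : EllTwo →L[ℂ] EllTwo :=
  weightedComp (fun k => Complex.exp (-(k : ℕ) * t * Complex.I)) id Function.injective_id 1
    (fun k => by
      have := Complex.norm_exp_ofReal_mul_I (-(k : ℕ) * t)
      push_cast at this
      exact this.le)

@[simp]
theorem freeEvolution_apply (t : ℝ) (x : EllTwo) (k : ℕ+) :
    freeEvolution t x k = Complex.exp (-(k : ℕ) * t * Complex.I) * x k := rfl

theorem ext_coord {x y : EllTwo} (h : ∀ k, x k = y k) : x = y := lp.ext (funext h)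

theorem ext_one_add_one {x y : EllTwo} (h1 : x 1 = y 1) (h : ∀ k, x (k + 1) = y (k + 1)) :
    x = y := ext_coord fun k => by
  induction k using PNat.recOn with
  | one => exact h1
  | succ k _ => exact h k

theorem star_raise : star raise = lower := star_star _

theorem lower_mul_raise : star raise * raise = 1 := by
  rw [star_raise]
  ext1 x
  exact ext_coord fun k => by simp

theorem star_invNumber : star invNumber = invNumber :=
  star_weightedComp_id _ _ fun k => by simp

/-- A form free of unbounded operators of the relation `N S = S (N + 1)`. -/
theorem invNumber_mul_raise : invNumber * raise * (1 + invNumber) = raise * invNumber := by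
  ext1 x
  refine ext_one_add_one (by simp) fun k => ?_
  have h1 : ((k : ℕ) : ℂ) ≠ 0 := by exact_mod_cast k.ne_zero
  have h2 : ((k : ℕ) : ℂ) + 1 ≠ 0 := Nat.cast_add_one_ne_zero _
  simp only [mul_apply_eq_comp, add_apply, one_apply_eq_self, invNumber_apply,
    raise_apply_add_one, lp.coeFn_add, Pi.add_apply, PNat.add_coe, PNat.one_coe, Nat.cast_add,
    Nat.cast_one]
  field_simp

/-- `R` fixes the ground state, onto which `1 - S S*` projects. -/
theorem invNumber_mul_ground : invNumber * (1 - raise * star raise) = 1 - raise * star raise := by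
  rw [star_raise]
  ext1 x
  exact ext_one_add_one (by simp) fun k => by simp

theorem invNumber_basisVec (k : ℕ+) : invNumber (basisVec k) = ((k : ℕ) : ℂ)⁻¹ • basisVec k :=
  ext_coord fun j => by
    rw [invNumber_apply, lp.coeFn_smul, Pi.smul_apply, basisVec_apply]
    split_ifs with h
    · rw [h]; rfl
    · simp

theorem lower_basisVec_one : star raise (basisVec 1) = 0 := by
  rw [star_raise]
  exact ext_coord fun k => by
    rw [lower_apply, basisVec_apply, if_neg (add_one_ne_one k)]; rfl

theorem injective_invNumber : Function.Injective invNumber := fun x y h => ext_coord fun k => by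
  have h2 : invNumber x k = invNumber y k := by rw [h]
  have h1 : ((k : ℕ) : ℂ) ≠ 0 := by exact_mod_cast k.ne_zero
  simpa [h1] using h2

theorem re_inner_invNumber_nonneg (x : EllTwo) : 0 ≤ (inner ℂ (invNumber x) x).re := by
  have h := (Complex.hasSum_iff _ _).1 (lp.hasSum_inner (𝕜 := ℂ) (invNumber x) x)
  refine h.1.nonneg fun k => ?_
  rw [invNumber_apply, RCLike.inner_apply, map_mul, mul_left_comm, Complex.mul_conj]
  simp only [map_inv₀, map_natCast]
  rw [← Complex.ofReal_natCast, ← Complex.ofReal_inv, ← Complex.ofReal_mul, Complex.ofReal_re]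
  exact mul_nonneg (by positivity) (Complex.normSq_nonneg _)

theorem star_freeEvolution (t : ℝ) : star (freeEvolution t) = freeEvolution (-t) :=
  star_weightedComp_id _ _ fun k => by
    rw [← Complex.exp_conj]
    simp

theorem freeEvolution_zero : freeEvolution 0 = 1 := by
  ext1 x
  exact ext_coord fun k => by simp

theorem freeEvolution_mem_unitary (t : ℝ) : freeEvolution t ∈ unitary (EllTwo →L[ℂ] EllTwo) := by
  have h : ∀ t, freeEvolution (-t) * freeEvolution t = 1 := fun t => by
    ext1 x
    refine ext_coord fun k => ?_
    rw [mul_apply_eq_comp, one_apply_eq_self, freeEvolution_apply, freeEvolution_apply, ← mul_assoc,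
      ← Complex.exp_add]
    simp
  refine Unitary.mem_iff.2 ⟨?_, ?_⟩
  · rw [star_freeEvolution, h]
  · rw [star_freeEvolution]
    simpa using h (-t)

theorem norm_freeEvolution_apply (t : ℝ) (x : EllTwo) : ‖freeEvolution t x‖ = ‖x‖ :=
  Unitary.norm_map (⟨_, freeEvolution_mem_unitary t⟩ : unitary (EllTwo →L[ℂ] EllTwo)) x

theorem freeEvolution_mul_invNumber (t : ℝ) :
    freeEvolution t * invNumber = invNumber * freeEvolution t := by
  ext1 x
  exact ext_coord fun k => by simp [mul_left_comm]

theorem freeEvolution_mul_raise (t : ℝ) :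
    Complex.exp (t * Complex.I) • (freeEvolution t * raise) = raise * freeEvolution t := by
  ext1 x
  refine ext_one_add_one (by simp) fun k => ?_
  simp only [smul_apply, mul_apply_eq_comp, lp.coeFn_smul, Pi.smul_apply, freeEvolution_apply,
    raise_apply_add_one, smul_eq_mul]
  rw [← mul_assoc, ← Complex.exp_add]
  congr 2
  push_cast
  ring

theorem freeEvolution_mul_lower (t : ℝ) :
    Complex.exp (-t * Complex.I) • (freeEvolution t * lower) = lower * freeEvolution t := by
  ext1 x
  refine ext_coord fun k => ?_
  simp only [smul_apply, mul_apply_eq_comp, lp.coeFn_smul, Pi.smul_apply, freeEvolution_apply,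
    lower_apply, smul_eq_mul]
  rw [← mul_assoc, ← Complex.exp_add]
  congr 2
  push_cast
  ring

theorem continuous_freeEvolution_const (x : EllTwo) : Continuous fun t => freeEvolution t x := by
  refine continuous_iff_continuousAt.2 fun s => ?_
  rw [ContinuousAt, tendsto_iff_norm_sub_tendsto_zero]
  have h : Continuous fun t => ‖freeEvolution t x - freeEvolution s x‖ ^ 2 := by
    simp only [norm_sq_eq_tsum]
    refine continuous_tsum (u := fun k => 4 * ‖x k‖ ^ 2) (fun k => ?_)
      ((summable_norm_sq x).mul_left 4) fun k t => ?_
    · simp only [lp.coeFn_sub, Pi.sub_apply, freeEvolution_apply]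
      fun_prop
    · have hn : ∀ t, ‖freeEvolution t x k‖ = ‖x k‖ := fun t => by
        have := Complex.norm_exp_ofReal_mul_I (-(k : ℕ) * t)
        push_cast at this
        rw [freeEvolution_apply, norm_mul, this, one_mul]
      rw [norm_pow, norm_norm, lp.coeFn_sub, Pi.sub_apply]
      have h2 := norm_sub_le (freeEvolution t x k) (freeEvolution s x k)
      rw [hn, hn] at h2
      calc _ ≤ (‖x k‖ + ‖x k‖) ^ 2 := by gcongr
        _ = _ := by ring
  have h2 := (h.tendsto s).sqrt
  simpa using h2

theorem continuous_freeEvolution_apply {g : ℝ → EllTwo} (hg : Continuous g) :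
    Continuous fun t => freeEvolution t (g t) := by
  refine continuous_iff_continuousAt.2 fun s => ?_
  have h1 : Filter.Tendsto (fun t => freeEvolution t (g t - g s)) (nhds s) (nhds 0) := by
    rw [tendsto_zero_iff_norm_tendsto_zero]
    simp only [norm_freeEvolution_apply]
    exact tendsto_iff_norm_sub_tendsto_zero.1 (hg.tendsto s)
  have h2 := h1.add ((continuous_freeEvolution_const (g s)).tendsto s)
  simpa [ContinuousAt] using h2

/-- A curve whose coordinates have the coordinates of a continuous curve `h` as derivatives is the
integral of `h`, hence differentiable in norm. -/
theorem hasDerivAt_of_coord {f h : ℝ → EllTwo} (hh : Continuous h)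
    (hf : ∀ k t, HasDerivAt (fun s => f s k) (h t k) t) (t : ℝ) : HasDerivAt f (h t) t := by
  have hint : ∀ t, f t = f 0 + ∫ s in (0 : ℝ)..t, h s := fun t => ext_coord fun k => by
    have h1 := (lp.evalCLM ℂ (fun _ : ℕ+ => ℂ) (p := 2) k).intervalIntegral_comp_comm
      (hh.intervalIntegrable (μ := volume) 0 t)
    have h2 : Continuous fun s => h s k :=
      (lp.evalCLM ℂ (fun _ : ℕ+ => ℂ) (p := 2) k).continuous.comp hh
    have h3 := intervalIntegral.integral_eq_sub_of_hasDerivAt (fun s _ => hf k s)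
      (h2.intervalIntegrable (μ := volume) 0 t)
    have h4 : (∫ s in (0 : ℝ)..t, h s k) = (∫ s in (0 : ℝ)..t, h s : EllTwo) k := h1
    rw [lp.coeFn_add, Pi.add_apply, ← h4, h3]
    ring
  have h5 := (intervalIntegral.integral_hasDerivAt_right (hh.intervalIntegrable (0 : ℝ) t)
    hh.stronglyMeasurable.stronglyMeasurableAtFilter hh.continuousAt).const_add (f 0)
  exact h5.congr_of_eventuallyEq (Filter.Eventually.of_forall hint)

/-- Product rule for `exp (t A) R g`. The free evolution is only strongly continuous, and it is `R`
that makes the curve differentiable, with `A R = -i`. -/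
theorem hasDerivAt_freeEvolution_invNumber {g g' : ℝ → EllTwo} (hg : ∀ t, HasDerivAt g (g' t) t)
    (hg' : Continuous g') (t : ℝ) :
    HasDerivAt (fun s => freeEvolution s (invNumber (g s)))
      (-Complex.I • freeEvolution t (g t) + freeEvolution t (invNumber (g' t))) t := by
  have hgc : Continuous g := continuous_iff_continuousAt.2 fun t => (hg t).continuousAt
  refine hasDerivAt_of_coord (f := fun s => freeEvolution s (invNumber (g s)))
    (h := fun t => -Complex.I • freeEvolution t (g t) + freeEvolution t (invNumber (g' t)))
    (((continuous_freeEvolution_apply hgc).const_smul (-Complex.I)).fun_add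
      (continuous_freeEvolution_apply (invNumber.continuous.comp hg'))) (fun k t => ?_) t
  have h1 : HasDerivAt (fun s => g s k) (g' t k) t :=
    ((lp.evalCLM ℂ (fun _ : ℕ+ => ℂ) (p := 2) k).restrictScalars ℝ).hasFDerivAt.comp_hasDerivAt t
      (hg t)
  have h2 : HasDerivAt (fun s : ℝ => Complex.exp (-(k : ℕ) * s * Complex.I))
      (-(k : ℕ) * Complex.I * Complex.exp (-(k : ℕ) * t * Complex.I)) t := by
    have h := (((Complex.ofRealCLM.hasDerivAt (x := t)).const_mul (-(k : ℕ) : ℂ)).mul_const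
      Complex.I).cexp
    refine h.congr_deriv ?_
    simp only [Complex.ofRealCLM_apply, Complex.ofReal_one]
    ring
  refine (h2.mul (h1.const_mul ((k : ℕ) : ℂ)⁻¹)).congr_deriv ?_
  have h3 : ((k : ℕ) : ℂ) ≠ 0 := by exact_mod_cast k.ne_zero
  simp only [lp.coeFn_add, Pi.add_apply, lp.coeFn_smul, Pi.smul_apply, freeEvolution_apply,
    invNumber_apply, smul_eq_mul]
  field_simp

end EllTwo

/-! ### The inverse of a bounded operator as a skew-adjoint operator -/

section SkewInverse

variable {H : Type*} [NormedAddCommGroup H] [InnerProductSpace ℂ H]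

/-- The operator `-i R⁻¹`, with domain the range of the injective bounded operator `R`. -/
noncomputable def skewInverse (R : H →L[ℂ] H) (hR : Function.Injective R) : H →ₗ.[ℂ] H where
  domain := (R : H →ₗ[ℂ] H).range
  toFun := (-Complex.I) • (LinearEquiv.ofInjective (R : H →ₗ[ℂ] H) hR).symm.toLinearMap

theorem skewInverse_apply {R : H →L[ℂ] H} (hR : Function.Injective R) (v : H)
    (h : R v ∈ (skewInverse R hR).domain) : skewInverse R hR ⟨R v, h⟩ = -Complex.I • v := by
  have : (LinearEquiv.ofInjective (R : H →ₗ[ℂ] H) hR).symm ⟨R v, h⟩ = v := by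
    rw [LinearEquiv.symm_apply_eq]; rfl
  change -Complex.I • (LinearEquiv.ofInjective (R : H →ₗ[ℂ] H) hR).symm ⟨R v, h⟩ = _
  rw [this]

theorem mem_skewInverse_domain {R : H →L[ℂ] H} (hR : Function.Injective R) (v : H) :
    R v ∈ (skewInverse R hR).domain := ⟨v, rfl⟩

/-- If `R` is self-adjoint then `-i R⁻¹` is skew-adjoint: for `y` in the domain of the adjoint, with
image `w`, testing on the range of `R` gives `y = R (-i w)`, so `y` is in the range of `R`. -/
theorem isSkewAdjointOp_skewInverse [CompleteSpace H] {R : H →L[ℂ] H}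
    (hR : Function.Injective R) (hs : star R = R) : IsSkewAdjointOp (skewInverse R hR) := by
  have hsym : ∀ x y, inner ℂ (R x) y = inner ℂ x (R y) := fun x y => by
    conv_lhs => rw [← hs, ContinuousLinearMap.star_eq_adjoint,
      ContinuousLinearMap.adjoint_inner_left]
  have hd : Dense ((skewInverse R hR).domain : Set H) := by
    rw [Submodule.dense_iff_topologicalClosure_eq_top, Submodule.topologicalClosure_eq_top_iff]
    refine (Submodule.eq_bot_iff _).2 fun x hx => hR ?_
    rw [map_zero]
    refine ext_inner_left ℂ fun v => ?_
    rw [← hsym, inner_zero_right]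
    exact (Submodule.mem_orthogonal _ _).1 hx _ ⟨v, rfl⟩
  have hle : -skewInverse R hR ≤ (skewInverse R hR).adjoint := by
    refine LinearPMap.IsFormalAdjoint.le_adjoint hd ?_
    rintro ⟨_, x, rfl⟩ ⟨_, y, rfl⟩
    change inner ℂ (skewInverse R hR ⟨R x, mem_skewInverse_domain hR x⟩) (R y) =
      inner ℂ (R x) (-(skewInverse R hR ⟨R y, mem_skewInverse_domain hR y⟩))
    rw [skewInverse_apply, skewInverse_apply, inner_neg_right, inner_smul_left, inner_smul_right,
      hsym]
    simp
  refine ⟨hd, Eq.symm (LinearPMap.eq_of_le_of_domain_eq hle ?_)⟩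
  refine le_antisymm hle.1 fun y hy => ?_
  have hf := LinearPMap.adjoint_isFormalAdjoint hd
  set w := (skewInverse R hR).adjoint ⟨y, hy⟩ with hw
  refine ⟨-Complex.I • w, ext_inner_right ℂ fun v => ?_⟩
  have h := hf ⟨y, hy⟩ ⟨R v, mem_skewInverse_domain hR v⟩
  rw [skewInverse_apply, ← hw] at h
  change inner ℂ (R (-Complex.I • w)) v = _
  rw [map_smul, inner_smul_left, hsym]
  change inner ℂ w (R v) = inner ℂ y _ at h
  rw [h, inner_smul_right, ← mul_assoc]
  simp

end SkewInverse

/-! ### Variation and absolute continuity of regular curves -/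

theorem eVariationOn_le_of_lipschitzWith {u : ℝ → ℝ} {C : NNReal} (hu : LipschitzWith C u)
    (a b : ℝ) :
    eVariationOn u (Set.Icc a b) ≤ C * ENNReal.ofReal (b - a) := by
  have h := hu.lipschitzOnWith (s := Set.univ) |>.comp_eVariationOn_le (g := id)
    (s := Set.Icc a b) (fun _ _ => trivial)
  refine h.trans ?_
  gcongr
  simp

theorem absolutelyContinuousOnInterval_of_hasDerivAt {E : Type*} [NormedAddCommGroup E]
    [NormedSpace ℝ E] {f f' : ℝ → E} (hf : ∀ t, HasDerivAt f (f' t) t) (hf' : Continuous f')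
    (a b : ℝ) : AbsolutelyContinuousOnInterval f a b := by
  obtain ⟨C, hC⟩ := isCompact_uIcc.exists_bound_of_continuousOn (s := Set.uIcc a b)
    hf'.continuousOn
  refine LipschitzOnWith.absolutelyContinuousOnInterval (K := C.toNNReal)
    ((convex_uIcc a b).lipschitzOnWith_of_nnnorm_hasDerivWithin_le
      (fun t _ => (hf t).hasDerivWithinAt) fun t ht => ?_)
  rw [← NNReal.coe_le_coe, coe_nnnorm]
  exact (hC t ht).trans (Real.le_coe_toNNReal C)

/-! ### The controlled system and its propagator -/

namespace EllTwo

/-- The standard Hilbert basis of `ℓ²(ℕ+)`. -/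
noncomputable def stdBasis : HilbertBasis ℕ+ ℂ EllTwo :=
  HilbertBasis.ofRepr (LinearIsometryEquiv.refl ℂ _)

theorem stdBasis_apply (k : ℕ+) : stdBasis k = basisVec k :=
  (stdBasis.repr_symm_single k).symm

instance : TopologicalSpace.SeparableSpace EllTwo := by
  have h := ((Set.countable_range stdBasis).isSeparable.span (R := ℂ)).closure
  rw [← Submodule.topologicalClosure_coe, stdBasis.dense_span, Submodule.top_coe] at h
  exact TopologicalSpace.isSeparable_univ_iff.1 h

/-- The drift `A = -i N`, with domain the sequences `x` such that `N x` is in `ℓ²(ℕ+)`, that is the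
range of `N⁻¹`. -/
noncomputable def hamiltonian : EllTwo →ₗ.[ℂ] EllTwo := skewInverse invNumber injective_invNumber

/-- The coupling `B = -i (S + S*)`. -/
noncomputable def coupling : EllTwo →L[ℂ] EllTwo := -Complex.I • (raise + star raise)

theorem star_coupling : star coupling = -coupling := by
  have hI : star (-Complex.I) = Complex.I := by
    rw [star_neg]; simp
  rw [coupling, star_smul, hI, star_add, star_star, neg_smul, neg_neg, add_comm]

theorem norm_coupling_le : ‖coupling‖ ≤ 2 := by
  have h : ‖raise‖ ≤ 1 := by
    exact (norm_star lower).trans_le norm_weightedComp_le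
  calc ‖coupling‖ = ‖raise + star raise‖ := by
        rw [coupling, norm_smul, norm_neg, Complex.norm_I, one_mul]
    _ ≤ ‖raise‖ + ‖star raise‖ := norm_add_le _ _
    _ ≤ 2 := by linarith [(norm_star raise : ‖star raise‖ = ‖raise‖)]

theorem isBilinearQuantumSystem :
    IsBilinearQuantumSystem hamiltonian (boundedOp coupling) stdBasis where
  skewAdjoint := isSkewAdjointOp_skewInverse _ star_invNumber
  positive := by
    rintro ⟨_, x, rfl⟩
    have h : Complex.I • hamiltonian ⟨invNumber x, x, rfl⟩ = x := by
      refine (congrArg (Complex.I • ·) (skewInverse_apply injective_invNumber x ⟨x, rfl⟩)).trans ?_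
      simp [smul_smul]
    exact (re_inner_invNumber_nonneg x).trans_eq
      (congrArg (fun w => (inner ℂ (invNumber x) w).re) h.symm)
  domain_le := le_top
  skewSymmetric := fun ψ χ _ _ => by
    change inner ℂ (coupling ψ) (χ : EllTwo) = -inner ℂ (ψ : EllTwo) (coupling χ)
    rw [← inner_neg_right, ← neg_apply, ← star_coupling,
      ContinuousLinearMap.star_eq_adjoint, ContinuousLinearMap.adjoint_inner_right]
  relativelyBounded := ⟨0, ‖coupling‖, fun ψ _ _ => by
    rw [zero_mul, zero_add]
    exact coupling.le_opNorm ψ⟩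
  eigenvectors := fun j => by
    have h1 : ((j : ℕ) : ℂ) ≠ 0 := by exact_mod_cast j.ne_zero
    have h : stdBasis j = invNumber (((j : ℕ) : ℂ) • basisVec j) := by
      rw [map_smul, invNumber_basisVec, smul_smul, mul_inv_cancel₀ h1, one_smul, stdBasis_apply]
    refine ⟨h ▸ mem_skewInverse_domain injective_invNumber _, (j : ℕ), ?_⟩
    simp only [h]
    have h2 := skewInverse_apply injective_invNumber (((j : ℕ) : ℂ) • basisVec j)
      (mem_skewInverse_domain injective_invNumber _)
    refine h2.trans ?_
    rw [map_smul, invNumber_basisVec, smul_smul, smul_smul, smul_smul]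
    congr 1
    field_simp
    simp

/-- The resonant drive is the coupling term in the interaction picture. -/
theorem freeEvolution_mul_resonantDrive (t : ℝ) :
    freeEvolution t * resonantDrive raise (star raise) t =
      (Real.sin t : ℂ) • (coupling * freeEvolution t) := by
  rw [resonantDrive, coupling, star_raise, mul_smul_comm, mul_add, mul_smul_comm, mul_smul_comm,
    freeEvolution_mul_raise, freeEvolution_mul_lower, ← add_mul, smul_mul_assoc, smul_smul,
    Complex.ofReal_sin]
  congr 1
  ring

/-- The propagator for the control `ε sin t`, together with `V₁ = N V N⁻¹`, where `V` is the
propagator in the interaction picture. The curve `t ↦ U t ψ` is differentiable at every time for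
`ψ` in the domain of the drift. -/
theorem exists_isPropagator (ε : ℝ) :
    ∃ (U : ℝ → (EllTwo ≃ₗᵢ[ℂ] EllTwo)) (V₁ : ℝ → EllTwo →L[ℂ] EllTwo),
      (∀ T, IsPropagator hamiltonian (boundedOp coupling) (fun t => ε * Real.sin t) T U) ∧
      V₁ 0 = 1 ∧
      (∀ t, HasDerivAt V₁ (((ε : ℂ) • resonantDrive (raise * (1 + invNumber))
        (star raise * (1 - invNumber)) t) * V₁ t) t) ∧
      ∀ t v, U t (invNumber v) = invNumber (freeEvolution t (V₁ t v)) := by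
  set S := raise
  set R := invNumber
  set P := S * (1 + R) with hPdef
  set Q := star S * (1 - R) with hQdef
  have hRP : R * P = S * R := by rw [hPdef, ← mul_assoc, invNumber_mul_raise]
  have hRQ : R * Q = star S * R := by
    have h := congrArg star invNumber_mul_raise
    simp only [star_mul, star_add, star_one, star_invNumber] at h
    change (1 + R) * (star S * R) = R * star S at h
    rw [hQdef, mul_sub (star S), mul_one, mul_sub, sub_eq_iff_eq_add, ← h]
    noncomm_ring
  have hLb : ∀ (P Q : EllTwo →L[ℂ] EllTwo) t, ‖(ε : ℂ) • resonantDrive P Q t‖ ≤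
      |ε| * (‖P‖ + ‖Q‖) := fun P Q t => by
    rw [norm_smul, Complex.norm_real, Real.norm_eq_abs]
    gcongr
    exact norm_resonantDrive_le P Q t
  have hLc : ∀ P Q : EllTwo →L[ℂ] EllTwo, Continuous fun t => (ε : ℂ) • resonantDrive P Q t :=
    fun P Q => (continuous_resonantDrive P Q).const_smul (ε : ℂ)
  obtain ⟨V, hV0, hV⟩ := exists_hasDerivAt_mul (fun t => (ε : ℂ) • resonantDrive S (star S) t)
    (hLc _ _) (hLb _ _)
  obtain ⟨V₁, hV₁0, hV₁⟩ := exists_hasDerivAt_mul (fun t => (ε : ℂ) • resonantDrive P Q t)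
    (hLc _ _) (hLb _ _)
  have hRL : ∀ t, R * resonantDrive P Q t = resonantDrive S (star S) t * R := fun t => by
    simp only [resonantDrive, mul_smul_comm, smul_mul_assoc, mul_add, add_mul, hRP, hRQ]
  -- Both sides solve `X' = ε (-i sin t) (e^{it} S + e^{-it} S*) X` with value `R` at time `0`.
  have hVR : (fun t => V t * R) = fun t => R * V₁ t := by
    refine eq_of_hasDerivAt_of_lipschitz (fun t X => ((ε : ℂ) • resonantDrive S (star S) t) * X)
      (C := |ε| * (‖S‖ + ‖star S‖)) (fun t X Y => ?_) (fun t => ?_) (fun t => ?_) (by simp [hV0, hV₁0])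
    · rw [← mul_sub]
      refine (norm_mul_le _ _).trans ?_
      gcongr
      exact hLb _ _ t
    · exact ((hV t).mul_const R).congr_deriv (mul_assoc _ _ _)
    · refine ((hV₁ t).const_mul R).congr_deriv ?_
      rw [← mul_assoc, mul_smul_comm, hRL, smul_mul_assoc, smul_mul_assoc,
        mul_assoc]
  have hVu : ∀ t, V t ∈ unitary (EllTwo →L[ℂ] EllTwo) :=
    mem_unitary_of_hasDerivAt (hLb _ _) (fun t => by
      rw [star_smul, star_resonantDrive, smul_neg]
      congr 2
      exact Complex.conj_ofReal ε) hV0 hV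
  set U : ℝ → (EllTwo ≃ₗᵢ[ℂ] EllTwo) := fun t => Unitary.linearIsometryEquiv
    (⟨freeEvolution t * V t, mul_mem (freeEvolution_mem_unitary t) (hVu t)⟩ :
      unitary (EllTwo →L[ℂ] EllTwo)) with hU
  have hUa : ∀ t x, U t x = freeEvolution t (V t x) := fun _ _ => rfl
  have hVRa : ∀ t v, V t (R v) = R (V₁ t v) := fun t v => congrArg (fun F => F t v) hVR
  have hUR : ∀ t v, U t (R v) = R (freeEvolution t (V₁ t v)) := fun t v => by
    rw [hUa, hVRa]
    exact congrArg (fun F => F (V₁ t v)) (freeEvolution_mul_invNumber t)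
  have hcont : ∀ x, Continuous fun t => U t x := fun x =>
    continuous_freeEvolution_apply
      (continuous_iff_continuousAt.2 fun t => ((hV t).clm_apply_const x).continuousAt)
  have hV₁c : ∀ v, Continuous fun t => V₁ t v := fun v =>
    continuous_iff_continuousAt.2 fun t => ((hV₁ t).clm_apply_const v).continuousAt
  have hder : ∀ v t, HasDerivAt (fun s => U s (R v))
      (-Complex.I • freeEvolution t (V₁ t v) +
        ((ε * Real.sin t : ℝ) : ℂ) • coupling (U t (R v))) t := fun v t => by
    have h := hasDerivAt_freeEvolution_invNumber (g := fun s => V₁ s v)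
      (fun t => (hV₁ t).clm_apply_const v)
      ((hLc P Q).clm_apply ((hV₁c v))) t
    have e : (fun s => U s (R v)) = fun s => freeEvolution s (R (V₁ s v)) := by
      funext s; rw [hUa, hVRa]
    rw [e]
    refine h.congr_deriv ?_
    congr 1
    have e1 : R ((((ε : ℂ) • resonantDrive P Q t) * V₁ t) v) =
        (ε : ℂ) • resonantDrive S (star S) t (R (V₁ t v)) := by
      rw [mul_apply_eq_comp, smul_apply, map_smul]
      congr 1
      exact congrArg (fun F => F (V₁ t v)) (hRL t)
    have e2 := congrArg (fun F => F (R (V₁ t v))) (freeEvolution_mul_resonantDrive t)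
    simp only [mul_apply_eq_comp, smul_apply] at e2
    rw [e1, map_smul, e2, smul_smul, hUa, hVRa]
    push_cast
    rfl
  refine ⟨U, V₁, fun T => ?_, hV₁0, hV₁, hUR⟩
  refine ⟨fun ψ => ?_, fun ψ => (hcont ψ).continuousOn, ?_, ?_, ?_⟩
  · rw [hUa, hV0, freeEvolution_zero]; rfl
  · rintro _ ⟨v, rfl⟩ t -
    exact ⟨_, (hUR t v).symm⟩
  · rintro _ ⟨v, rfl⟩
    refine absolutelyContinuousOnInterval_of_hasDerivAt (hder v) ?_ 0 T
    refine ((continuous_freeEvolution_apply (hV₁c v)).const_smul (-Complex.I)).fun_add ?_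
    have := coupling.continuous.comp (hcont (R v))
    have hu : Continuous fun t : ℝ => ((ε * Real.sin t : ℝ) : ℂ) := by fun_prop
    exact hu.smul this
  · rintro _ ⟨v, rfl⟩
    refine Filter.Eventually.of_forall fun t => ?_
    have hm : U t (R v) ∈ hamiltonian.domain := ⟨_, (hUR t v).symm⟩
    refine ⟨hm, trivial, (hder v t).congr_deriv ?_⟩
    have h2 : hamiltonian ⟨U t (R v), hm⟩ = -Complex.I • freeEvolution t (V₁ t v) := by
      simp only [hUR]
      exact skewInverse_apply injective_invNumber _ _
    change _ = hamiltonian ⟨U t (R v), hm⟩ + _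
    rw [h2]
    rfl

end EllTwo

/-! ### Energy growth against total variation -/

open EllTwo in
theorem proposition1 :
    ∃ (H : Type) (_ : NormedAddCommGroup H) (_ : InnerProductSpace ℂ H) (_ : CompleteSpace H)
      (_ : TopologicalSpace.SeparableSpace H)
      (A : H →ₗ.[ℂ] H) (B : H →L[ℂ] H) (φ : HilbertBasis ℕ+ ℂ H),
      IsBilinearQuantumSystem A (boundedOp B) φ ∧
      ∀ M : ℝ, 0 ≤ M →
        ∃ (T : ℝ) (u : ℝ → ℝ) (U : ℝ → (H ≃ₗᵢ[ℂ] H)),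
          0 < T ∧ u 0 = 0 ∧ BoundedVariationOn u (Set.Icc 0 T) ∧
          IsPropagator A (boundedOp B) u T U ∧
          (∃ h : U T (φ 1) ∈ A.domain, M ≤ ‖A ⟨U T (φ 1), h⟩‖) ∧
          ‖B‖ / 4 * (eVariationOn u (Set.Icc 0 T)).toReal ≤ M := by
  refine ⟨EllTwo, inferInstance, inferInstance, inferInstance, inferInstance, hamiltonian,
    coupling, stdBasis, isBilinearQuantumSystem, fun M hM => ?_⟩
  have hφ : stdBasis 1 = invNumber (basisVec 1) := by
    rw [invNumber_basisVec, stdBasis_apply]; simp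
  obtain ⟨ε, T, hε, hT, hεT, hgrow⟩ : ∃ ε T : ℝ, 0 ≤ ε ∧ 0 < T ∧ ε * T = 2 * M ∧
      ∀ x : ℝ → EllTwo, x 0 = basisVec 1 → (∀ t, HasDerivAt x ((ε : ℂ) •
        resonantDrive (raise * (1 + invNumber)) (star raise * (1 - invNumber)) t (x t)) t) →
        M ≤ ‖x T‖ := by
    rcases hM.eq_or_lt with rfl | hM
    -- For `M = 0` the free evolution suffices.
    · exact ⟨0, 1, le_rfl, one_pos, by simp, fun _ _ _ => norm_nonneg _⟩
    · obtain ⟨ε, hε, h⟩ := exists_le_norm_of_hasDerivAt_resonantDrive lower_mul_raise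
        star_invNumber invNumber_mul_raise invNumber_mul_ground (norm_basisVec 1)
        (by rw [invNumber_basisVec]; simp) lower_basisVec_one hM
      exact ⟨ε, 2 * M / ε, hε.le, by positivity, by field_simp, h⟩
  obtain ⟨U, V₁, hU, hV₁0, hV₁, hUV⟩ := exists_isPropagator ε
  have hlip : LipschitzWith ε.toNNReal fun t => ε * Real.sin t :=
    LipschitzWith.of_dist_le_mul fun x y => by
      rw [Real.coe_toNNReal ε hε, Real.dist_eq, ← mul_sub, abs_mul, abs_of_nonneg hε]
      gcongr
      rw [Real.dist_eq]
      exact Real.abs_sin_sub_sin_le x y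
  have hvar : eVariationOn (fun t => ε * Real.sin t) (Set.Icc 0 T) ≤ ENNReal.ofReal (2 * M) := by
    refine (eVariationOn_le_of_lipschitzWith hlip 0 T).trans (le_of_eq ?_)
    rw [sub_zero, ← hεT, ENNReal.ofReal_mul hε]
    rfl
  have hmem : U T (stdBasis 1) = invNumber (freeEvolution T (V₁ T (basisVec 1))) := by
    rw [hφ, hUV]
  refine ⟨T, fun t => ε * Real.sin t, U, hT, by simp, ne_top_of_le_ne_top ENNReal.ofReal_ne_top hvar,
    hU T, ⟨⟨_, hmem.symm⟩, ?_⟩, ?_⟩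
  · have h2 : hamiltonian ⟨U T (stdBasis 1), ⟨_, hmem.symm⟩⟩ =
        -Complex.I • freeEvolution T (V₁ T (basisVec 1)) := by
      simp only [hmem]
      exact skewInverse_apply injective_invNumber _ _
    rw [h2, norm_smul, norm_freeEvolution_apply, norm_neg, Complex.norm_I, one_mul]
    exact hgrow (fun t => V₁ t (basisVec 1)) (by simp [hV₁0])
      fun t => (hV₁ t).clm_apply_const (basisVec 1)
  · have h1 := ENNReal.toReal_mono ENNReal.ofReal_ne_top hvar
    rw [ENNReal.toReal_ofReal (by positivity)] at h1
    calc ‖coupling‖ / 4 * (eVariationOn (fun t => ε * Real.sin t) (Set.Icc 0 T)).toReal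
        ≤ 2 / 4 * (2 * M) := by gcongr; exact norm_coupling_le
      _ = M := by ring
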